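/- Let $A$ be a $C^*$-algebra (not necessarily unital) and let $E,F$ be Hilbert $C^*$-modules over $A$ (all on the same side; left and right modules are interchanged by passing to the opposite algebra). Write $\mathcal L(E,F)$ for the adjointable operators from $E$ to $F$, $\mathcal L(E)=\mathcal L(E,E)$. For a densely defined $A$-linear operator $T$ from within $E$ into $F$, the adjoint $T^*$ from within $F$ into $E$ has domain $$D(T^*)=\{v\in F\mid \exists\, w\in E:\ \langle Tu,v\rangle=\langle u,w\rangle \text{ for all } u\in D(T)\},$$ and $T^*v$ is the (unique) such $w$. The operator $T$ is called regular, $T\in\mathcal R(E,F)$, if it is $A$-linear, densely defined and closed, $T^*$ is densely defined, and $1+T^*T$ has dense range. A regular operator $T\in\mathcal R(E,F)$ is called invertible if $T$ is injective and $T^{-1}\in\mathcal R(F,E)$. An operator $T\in\mathcal R(E)=\mathcal R(E,E)$ is called normal if $D(T)=D(T^*)$ and $\langle Tv,Tv\rangle=\langle T^*v,T^*v\rangle$ for all $v\in D(T)$. Then: 1. For $T\in\mathcal R(E,F)$: $T$ is invertible if and only if both $T$ and $T^*$ have dense range. 2. For $T\in\mathcal R(E,F)$ there is a unique $z_T\in\mathcal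 L(E,F)$ with $\|z_T\|\le 1$ such that $D(T)=(1-z_T^*z_T)^{1/2}E$ and $T\bigl((1-z_T^*z_T)^{1/2}v\bigr)=z_Tv$ for all $v\in E$; and $T$ is invertible if and only if $z_T$ is invertible (as an element of $\mathcal R(E,F)$, i.e. $z_T$ is injective and $z_T^{-1}\in\mathcal R(F,E)$). 3. If $T\in\mathcal R(E)$ is normal, then $T$ is invertible if and only if $T$ has dense range. -/

import Mathlib

/-!
Regular operators between Hilbert C⋆-modules.

A Hilbert C⋆-module over the C⋆-algebra `A` is a type `E` with
`[NormedAddCommGroup E] [NormedSpace ℂ E] [SMul A E] [CStarModule A E] [CompleteSpace E]`;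
the class `CStarModule` contains the requirement that the norm of `E` is the one induced by the
`A`-valued inner product `inner A x y`.  Operators "from within `E` into `F`" are partially defined
linear maps `E →ₗ.[ℂ] F`.
-/

namespace HilbertModule

noncomputable section

variable (A : Type*) {E F : Type*}
  [NonUnitalCStarAlgebra A] [PartialOrder A]
  [NormedAddCommGroup E] [NormedSpace ℂ E] [SMul A E] [CStarModule A E]
  [NormedAddCommGroup F] [NormedSpace ℂ F] [SMul A F] [CStarModule A F]

/-- The (complex linear) partially defined operator `T` is `A`-linear: its domain is stable under
the action of `A` and `T` commutes with this action. -/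
def IsModuleLinear (T : E →ₗ.[ℂ] F) : Prop :=
  ∀ (a : A) (x : T.domain), ∃ h : a • (x : E) ∈ T.domain, T ⟨a • (x : E), h⟩ = a • T x

/-- The set of all `(v, w)` in `F × E` such that `⟨T u, v⟩ = ⟨u, w⟩` for every `u` in the domain
of `T`. -/
def adjointGraph (T : E →ₗ.[ℂ] F) : Submodule ℂ (F × E) where
  carrier := {p | ∀ u : T.domain, inner A (T u) p.1 = inner A (u : E) p.2}
  add_mem' {p q} hp hq u := by
    simp [hp u, hq u]
  zero_mem' u := by simp
  smul_mem' c p hp u := by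
    simp [hp u]

/-- The adjoint of a densely defined operator: its domain consists of all `v` for which there is
`w` with `⟨T u, v⟩ = ⟨u, w⟩` for every `u` in the domain of `T`, and it sends `v` to this `w`
(see `mem_graph_adjoint`). -/
def adjoint (T : E →ₗ.[ℂ] F) : F →ₗ.[ℂ] E :=
  (adjointGraph A T).toLinearPMap

/-- For densely defined `T`, the operator `adjoint A T` is the one described in its docstring. -/
theorem mem_graph_adjoint [StarOrderedRing A] {T : E →ₗ.[ℂ] F} (hT : Dense (T.domain : Set E))
    (v : F) (w : E) :
    (v, w) ∈ (adjoint A T).graph ↔ ∀ u : T.domain, inner A (T u) v = inner A (u : E) w := by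
  rw [adjoint, Submodule.toLinearPMap_graph_eq]
  · rfl
  · rintro ⟨v, w⟩ hvw rfl
    have h0 : ∀ u ∈ (T.domain : Set E), inner A u w = 0 := fun u hu => by
      have := hvw ⟨u, hu⟩
      simpa using this.symm
    have hc : Continuous fun u : E => inner A u w :=
      CStarModule.continuous_inner.comp (continuous_id.prodMk continuous_const)
    have h1 := hc.ext_on hT (continuous_const (y := (0 : A))) h0
    exact CStarModule.inner_self.mp (congrFun h1 w)

/-- The range of the operator `1 + T⋆T`, where `T⋆T` has domain
`{x ∈ D(T) | T x ∈ D(T⋆)}`. -/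
def rangeOneAddAdjointMul (T : E →ₗ.[ℂ] F) : Set E :=
  {y | ∃ (x : T.domain) (h : T x ∈ (adjoint A T).domain), y = x + adjoint A T ⟨T x, h⟩}

/-- `T` is a regular operator from within `E` into `F`, that is, `T ∈ R(E, F)`. -/
structure IsRegular (T : E →ₗ.[ℂ] F) : Prop where
  isModuleLinear : IsModuleLinear A T
  dense_domain : Dense (T.domain : Set E)
  isClosed : T.IsClosed
  dense_adjoint_domain : Dense ((adjoint A T).domain : Set F)
  dense_range : Dense (rangeOneAddAdjointMul A T)

/-- Invertibility of a regular operator: `T` is injective and `T⁻¹ ∈ R(F, E)`. -/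
def IsInvertible (T : E →ₗ.[ℂ] F) : Prop :=
  Function.Injective T ∧ IsRegular A T.inverse

/-- Normality: `D(T) = D(T⋆)` and `⟨T v, T v⟩ = ⟨T⋆ v, T⋆ v⟩` for every `v` in this domain. -/
def IsNormal (T : E →ₗ.[ℂ] E) : Prop :=
  T.domain = (adjoint A T).domain ∧
    ∀ (v : E) (h : v ∈ T.domain) (h' : v ∈ (adjoint A T).domain),
      inner A (T ⟨v, h⟩) (T ⟨v, h⟩) = inner A (adjoint A T ⟨v, h'⟩) (adjoint A T ⟨v, h'⟩)

/-- `z` and `w` are adjointable operators and `w = z⋆`. -/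
def IsAdjointPair (z : E →L[ℂ] F) (w : F →L[ℂ] E) : Prop :=
  ∀ x y, inner A (z x) y = inner A x (w y)

/-- `s` is a positive element of the C⋆-algebra `L(E)` of adjointable operators on `E`:
it is of the form `c⋆c` with `c ∈ L(E)`. -/
def IsPositive (s : E →L[ℂ] E) : Prop :=
  ∃ c d : E →L[ℂ] E, IsAdjointPair A c d ∧ s = d ∘L c

/-- `s = (1 - z⋆z)^(1/2)`, the positive square root in `L(E)`, for an adjointable `z`. -/
def IsSqrtOneSub (z : E →L[ℂ] F) (s : E →L[ℂ] E) : Prop :=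
  IsPositive A s ∧
    ∃ w : F →L[ℂ] E, IsAdjointPair A z w ∧ s ∘L s = ContinuousLinearMap.id ℂ E - w ∘L z

/-- `z` is the `z`-transform of `T`: it is an adjointable operator with `‖z‖ ≤ 1` such that
`D(T) = (1 - z⋆z)^(1/2) E` and `T ((1 - z⋆z)^(1/2) v) = z v` for every `v`. -/
def IsZTransform (T : E →ₗ.[ℂ] F) (z : E →L[ℂ] F) : Prop :=
  ‖z‖ ≤ 1 ∧ ∃ s : E →L[ℂ] E, IsSqrtOneSub A z s ∧
    (T.domain : Set E) = Set.range s ∧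
    ∀ (v : E) (h : s v ∈ T.domain), T ⟨s v, h⟩ = z v

/-- An everywhere defined bounded operator, seen as a partially defined one. -/
def ofCLM (z : E →L[ℂ] F) : E →ₗ.[ℂ] F :=
  (z : E →ₗ[ℂ] F).toPMap ⊤

end

end HilbertModule

/-!
For regular `T`, the identity `⟨x, (1 + T⋆T) x⟩ = ⟨x, x⟩ + ⟨T x, T x⟩` shows that `1 + T⋆T` is
bounded below on the closed space of triples `(x, T x, T⋆ T x)`, so that it is onto and has a
bounded positive inverse `R`. With `s = R^(1/2)`, which has dense range, the `z`-transform is the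
continuous extension of `T R s⁻¹`; it satisfies `z⋆z = 1 - s²`. Since `x = s (s x + z⋆ u)` for
every `x` in `D(T⋆⋆)` with `u = T⋆⋆ x`, the graph of `T` is `{(s v, z v)}` and `T⋆⋆ = T`.

Regularity of `T⋆` and, if `T` and `T⋆` have dense range, of `T⁻¹` holds because the range of
`1 + TT⋆`, which is also that of `1 + (T⁻¹)⋆T⁻¹`, contains `D(T⋆)`: for `v` in `D(T⋆)` the element
`v - T R T⋆ v` of `D(T⋆)` is sent by `T⋆` to `R T⋆ v`. This gives the criterion for invertibility.
It transfers to `z` because `T` and `z` have the same range, `s T⋆` is contained in `z⋆`, the range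
of `z⋆z` is contained in that of `T⋆`, and `z⋆z` has dense range as soon as `z⋆` does.

For normal `T`, polarization gives `⟨T x, T y⟩ = ⟨T⋆ x, T⋆ y⟩` and hence `TT⋆ ⊆ T⋆T`. If `T` has
dense range, then so has `TT⋆`, hence also `T⋆`.
-/

namespace HilbertModule

open CStarModule

section Graph

variable {A E F : Type*} [SMul A E] [SMul A F]
  [NormedAddCommGroup E] [NormedSpace ℂ E] [NormedAddCommGroup F] [NormedSpace ℂ F]

theorem isModuleLinear_iff {T : E →ₗ.[ℂ] F} : IsModuleLinear A T ↔
    ∀ (a : A) (x : E) (u : F), (x, u) ∈ T.graph → (a • x, a • u) ∈ T.graph := by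
  constructor
  · intro h a x u hx
    obtain ⟨x, rfl, rfl⟩ := (LinearPMap.mem_graph_iff T).1 hx
    obtain ⟨hax, hTax⟩ := h a x
    exact hTax ▸ T.mem_graph ⟨_, hax⟩
  · intro h a x
    have hax : (a • (x : E), a • T x) ∈ T.graph := h a _ _ (T.mem_graph x)
    have hdom := LinearPMap.mem_domain_of_mem_graph hax
    exact ⟨hdom, T.mem_graph_snd_inj (T.mem_graph ⟨_, hdom⟩) hax rfl⟩

theorem mem_graph_ofCLM {z : E →L[ℂ] F} {x : E} {u : F} : (x, u) ∈ (ofCLM z).graph ↔ z x = u := by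
  rw [LinearPMap.mem_graph_iff]
  constructor
  · rintro ⟨x, rfl, rfl⟩
    rfl
  · rintro rfl
    exact ⟨⟨x, trivial⟩, rfl, rfl⟩

theorem range_ofCLM (z : E →L[ℂ] F) : Set.range (ofCLM z) = Set.range z := by
  ext u
  rw [LinearPMap.mem_range_iff]
  exact exists_congr fun x => mem_graph_ofCLM

theorem dense_domain_ofCLM (z : E →L[ℂ] F) : Dense ((ofCLM z).domain : Set E) :=
  dense_univ

theorem isClosed_ofCLM (z : E →L[ℂ] F) : (ofCLM z).IsClosed := by
  have hgraph : ((ofCLM z).graph : Set (E × F)) = {p | z p.1 = p.2} :=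
    Set.ext fun _ => mem_graph_ofCLM
  rw [LinearPMap.IsClosed, hgraph]
  exact isClosed_eq (by fun_prop) (by fun_prop)

theorem mem_graph_inverse {T : E →ₗ.[ℂ] F} (hT : Function.Injective T) {x : E} {u : F} :
    (u, x) ∈ T.inverse.graph ↔ (x, u) ∈ T.graph := by
  rw [LinearPMap.inverse_graph (LinearMap.ker_eq_bot.2 hT)]
  constructor
  · rintro ⟨⟨x', u'⟩, h, hswap⟩
    obtain ⟨rfl, rfl⟩ := Prod.mk.inj hswap
    exact h
  · exact fun h => ⟨(x, u), h, rfl⟩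

theorem coe_domain_inverse (T : E →ₗ.[ℂ] F) : (T.inverse.domain : Set F) = Set.range T := by
  rw [LinearPMap.inverse_domain]
  rfl

end Graph

variable {A E F G : Type*} [NonUnitalCStarAlgebra A] [PartialOrder A]
  [NormedAddCommGroup E] [NormedSpace ℂ E] [SMul A E] [CStarModule A E]
  [NormedAddCommGroup F] [NormedSpace ℂ F] [SMul A F] [CStarModule A F]
  [NormedAddCommGroup G] [NormedSpace ℂ G] [SMul A G] [CStarModule A G]

section Inner

variable (A)

theorem inner_eq_inner_comm {x y : E} {u v : F} :
    inner A x y = inner A u v ↔ inner A y x = inner A v u := by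
  rw [← star_inner x y, ← star_inner u v, star_inj]

theorem four_smul_inner_eq_sum (x y : E) :
    (4 : ℂ) • inner A x y = ∑ k ∈ Finset.range 4,
      (-Complex.I) ^ k • inner A (x + Complex.I ^ k • y) (x + Complex.I ^ k • y) := by
  simp only [Finset.sum_range_succ, Finset.sum_range_zero, pow_succ, pow_zero, one_mul,
    Complex.I_mul_I, neg_mul, mul_neg, neg_neg, CStarModule.inner_add_left,
    CStarModule.inner_add_right, inner_smul_left_complex, inner_smul_right_complex,
    Complex.star_def, map_neg, map_one, Complex.conj_I, smul_add, smul_smul]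
  module

variable [StarOrderedRing A]

theorem ext_inner_left_of_dense {D : Set E} (hD : Dense D) {x y : E}
    (h : ∀ u ∈ D, inner A u x = inner A u y) : x = y := by
  have hcont (v : E) : Continuous fun u : E => inner A u v := by fun_prop
  have hxy : inner A (x - y) x = inner A (x - y) y :=
    congrFun ((hcont x).ext_on hD (hcont y) h) (x - y)
  rwa [← sub_eq_zero, ← CStarModule.inner_sub_right, inner_self, sub_eq_zero] at hxy

theorem ext_inner_left {x y : E} (h : ∀ u, inner A u x = inner A u y) : x = y :=
  ext_inner_left_of_dense A dense_univ fun u _ => h u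

theorem norm_sq_le_of_inner_self_le_inner {x : E} {y y' : F}
    (h : inner A x x ≤ inner A y y') : ‖x‖ ^ 2 ≤ ‖y‖ * ‖y'‖ := calc
  ‖x‖ ^ 2 = ‖inner A x x‖ := norm_sq_eq A
  _ ≤ ‖inner A y y'‖ :=
    CStarAlgebra.norm_le_norm_of_nonneg_of_le CStarModule.inner_self_nonneg h
  _ ≤ ‖y‖ * ‖y'‖ := CStarModule.norm_inner_le F

theorem norm_le_of_inner_self_le_inner {x : E} {y y' : F} (h : inner A x x ≤ inner A y y')
    (hy : ‖y‖ ≤ ‖y'‖) : ‖x‖ ≤ ‖y'‖ := by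
  refine le_of_sq_le_sq ?_ (norm_nonneg y')
  calc ‖x‖ ^ 2 ≤ ‖y‖ * ‖y'‖ := norm_sq_le_of_inner_self_le_inner A h
    _ ≤ ‖y'‖ ^ 2 := by rw [sq]; gcongr

theorem norm_le_of_inner_self_le_inner_left {x y : E} (h : inner A x x ≤ inner A x y) :
    ‖x‖ ≤ ‖y‖ := by
  rcases (norm_nonneg x).eq_or_lt with hx | hx
  · exact hx ▸ norm_nonneg y
  · refine le_of_mul_le_mul_left ?_ hx
    rw [← sq]
    exact norm_sq_le_of_inner_self_le_inner A h

theorem norm_le_opNorm_mul_of_inner_apply_eq (z : E →L[ℂ] F) {v : F} {w : E}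
    (h : ∀ x, inner A (z x) v = inner A x w) : ‖w‖ ≤ ‖z‖ * ‖v‖ := by
  rcases (norm_nonneg w).eq_or_lt with hw | hw
  · exact hw ▸ by positivity
  · refine le_of_mul_le_mul_left ?_ hw
    calc ‖w‖ * ‖w‖ = ‖inner A (z w) v‖ := by rw [h, ← norm_sq_eq A, sq]
      _ ≤ ‖z w‖ * ‖v‖ := CStarModule.norm_inner_le F
      _ ≤ ‖z‖ * ‖w‖ * ‖v‖ := by gcongr; exact z.le_opNorm w
      _ = ‖w‖ * (‖z‖ * ‖v‖) := by ring

end Inner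

section AdjointPair

variable {z z' : E →L[ℂ] F} {w w' : F →L[ℂ] E}

namespace IsAdjointPair

theorem symm (h : IsAdjointPair A z w) : IsAdjointPair A w z := fun x y =>
  ((inner_eq_inner_comm A).1 (h y x)).symm

theorem add (h : IsAdjointPair A z w) (h' : IsAdjointPair A z' w') :
    IsAdjointPair A (z + z') (w + w') := fun x y => by simp [h x y, h' x y]

theorem sub (h : IsAdjointPair A z w) (h' : IsAdjointPair A z' w') :
    IsAdjointPair A (z - z') (w - w') := fun x y => by simp [h x y, h' x y]

theorem smul (h : IsAdjointPair A z w) (c : ℂ) :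
    IsAdjointPair A (c • z) (star c • w) := fun x y => by simp [h x y]

theorem comp {u : F →L[ℂ] G} {v : G →L[ℂ] F} (h' : IsAdjointPair A u v)
    (h : IsAdjointPair A z w) : IsAdjointPair A (u ∘L z) (w ∘L v) := fun x y => by
  simp [h' (z x) y, h x (v y)]

theorem id : IsAdjointPair A (ContinuousLinearMap.id ℂ E) (ContinuousLinearMap.id ℂ E) :=
  fun _ _ => rfl

variable [StarOrderedRing A]

theorem unique (h : IsAdjointPair A z w) (h' : IsAdjointPair A z w') : w = w' :=
  ContinuousLinearMap.ext fun y => ext_inner_left A fun x => by rw [← h, ← h']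

theorem map_smul (h : IsAdjointPair A z w) (a : A) (x : E) : z (a • x) = a • z x :=
  ext_inner_left A fun u => by
    rw [← h.symm u, inner_op_smul_right, inner_op_smul_right, h.symm u]

theorem norm_le (h : IsAdjointPair A z w) : ‖w‖ ≤ ‖z‖ :=
  w.opNorm_le_bound (norm_nonneg z) fun y =>
    norm_le_opNorm_mul_of_inner_apply_eq A z fun x => h x y

theorem norm_mul_norm_le_norm_comp (h : IsAdjointPair A z w) : ‖z‖ * ‖z‖ ≤ ‖w ∘L z‖ := by
  have hsqrt : ‖z‖ ≤ √‖w ∘L z‖ := by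
    refine z.opNorm_le_bound (Real.sqrt_nonneg _) fun x => ?_
    refine le_of_sq_le_sq ?_ (by positivity)
    calc ‖z x‖ ^ 2 = ‖inner A x (w (z x))‖ := by rw [norm_sq_eq A, h]
      _ ≤ ‖x‖ * ‖w (z x)‖ := CStarModule.norm_inner_le E
      _ ≤ ‖x‖ * (‖w ∘L z‖ * ‖x‖) := by gcongr; exact (w ∘L z).le_opNorm x
      _ = (√‖w ∘L z‖ * ‖x‖) ^ 2 := by rw [mul_pow, Real.sq_sqrt (norm_nonneg _)]; ring
  calc ‖z‖ * ‖z‖ ≤ √‖w ∘L z‖ * √‖w ∘L z‖ := by gcongr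
    _ = ‖w ∘L z‖ := Real.mul_self_sqrt (norm_nonneg _)

end IsAdjointPair

variable [StarOrderedRing A]

theorem exists_isAdjointPair_of_dense [CompleteSpace E] (z : E →L[ℂ] F) {D : Submodule ℂ F}
    (hD : Dense (D : Set F)) (h : ∀ v ∈ D, ∃ w, ∀ x, inner A (z x) v = inner A x w) :
    ∃ w : F →L[ℂ] E, IsAdjointPair A z w := by
  choose f hf using fun v : D => h v v.2
  let g : D →ₗ[ℂ] E :=
    { toFun := f
      map_add' u v := ext_inner_left A fun x => by simp [← hf]
      map_smul' c v := ext_inner_left A fun x => by simp [← hf] }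
  have hbound (v : D) : ‖g v‖ ≤ ‖z‖ * ‖D.subtype v‖ :=
    norm_le_opNorm_mul_of_inner_apply_eq A z (hf v)
  have hdense : DenseRange D.subtype := by simpa [DenseRange] using! hD
  refine ⟨g.extendOfNorm D.subtype, fun x => congrFun (hdense.equalizer ?_ ?_ (funext fun v => ?_))⟩
  · fun_prop
  · fun_prop
  · rw [Function.comp_apply, Function.comp_apply, LinearMap.extendOfNorm_eq hdense ⟨_, hbound⟩]
    exact hf v x

end AdjointPair

section Adjointable

variable (A E) in
/-- The algebra `L(E)` of adjointable operators on a Hilbert C⋆-module. Its star is the adjoint,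
and its order is the spectral order of a C⋆-algebra. -/
def adjointable : Subalgebra ℂ (E →L[ℂ] E) where
  carrier := {z | ∃ w, IsAdjointPair A z w}
  mul_mem' := fun ⟨_, h⟩ ⟨_, h'⟩ => ⟨_, h.comp h'⟩
  add_mem' := fun ⟨_, h⟩ ⟨_, h'⟩ => ⟨_, h.add h'⟩
  algebraMap_mem' c := ⟨_, Algebra.algebraMap_eq_smul_one (A := E →L[ℂ] E) c ▸
    IsAdjointPair.id.smul c⟩

noncomputable instance : Star (adjointable A E) where
  star z := ⟨z.2.choose, z.1, z.2.choose_spec.symm⟩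

theorem isAdjointPair_star (z : adjointable A E) :
    IsAdjointPair A (z : E →L[ℂ] E) (star z : adjointable A E) := z.2.choose_spec

variable [StarOrderedRing A]

theorem star_eq_of_isAdjointPair {z w : adjointable A E}
    (h : IsAdjointPair A (z : E →L[ℂ] E) w) : star z = w :=
  Subtype.ext ((isAdjointPair_star z).unique h)

theorem isClosed_adjointable [CompleteSpace E] :
    IsClosed (adjointable A E : Set (E →L[ℂ] E)) := by
  let P : Set ((E →L[ℂ] E) × (E →L[ℂ] E)) := {p | IsAdjointPair A p.1 p.2}
  have hP : IsClosed P := by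
    simp only [P, IsAdjointPair, Set.ofPred_forall]
    exact isClosed_iInter fun x => isClosed_iInter fun y => isClosed_eq (by fun_prop) (by fun_prop)
  have : CompleteSpace P := hP.completeSpace_coe
  have hfst : AntilipschitzWith 1 fun p : P => p.1.1 :=
    AntilipschitzWith.of_le_mul_dist fun p q => by
      rw [NNReal.coe_one, one_mul, Subtype.dist_eq, Prod.dist_eq, dist_eq_norm, dist_eq_norm]
      exact max_le le_rfl (p.2.sub q.2).norm_le
  have hrange : (adjointable A E : Set (E →L[ℂ] E)) = Set.range fun p : P => p.1.1 := by
    ext z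
    exact ⟨fun ⟨w, h⟩ => ⟨⟨(z, w), h⟩, rfl⟩, fun ⟨p, hp⟩ => ⟨p.1.2, hp ▸ p.2⟩⟩
  rw [hrange]
  exact hfst.isClosed_range (uniformContinuous_fst.comp uniformContinuous_subtype_val)

noncomputable instance : StarRing (adjointable A E) where
  star_involutive z := star_eq_of_isAdjointPair (isAdjointPair_star z).symm
  star_mul z w := star_eq_of_isAdjointPair ((isAdjointPair_star z).comp (isAdjointPair_star w))
  star_add z w := star_eq_of_isAdjointPair ((isAdjointPair_star z).add (isAdjointPair_star w))

instance : StarModule ℂ (adjointable A E) where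
  star_smul c z := star_eq_of_isAdjointPair ((isAdjointPair_star z).smul c)

instance : CStarRing (adjointable A E) where
  norm_mul_self_le z := (isAdjointPair_star z).norm_mul_norm_le_norm_comp

variable [CompleteSpace E]

noncomputable instance : CStarAlgebra (adjointable A E) where
  toCompleteSpace := isClosed_adjointable.completeSpace_coe

noncomputable instance : PartialOrder (adjointable A E) :=
  CStarAlgebra.spectralOrder _

instance : StarOrderedRing (adjointable A E) :=
  CStarAlgebra.spectralOrderedRing _

end Adjointable

section Positive

theorem IsPositive.isAdjointPair {s : E →L[ℂ] E} (h : IsPositive A s) : IsAdjointPair A s s := by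
  obtain ⟨c, d, h, rfl⟩ := h
  exact h.symm.comp h

theorem IsPositive.apply_eq_zero_of_inner_nonpos {s : E →L[ℂ] E} (h : IsPositive A s) {x : E}
    (hx : inner A (s x) x ≤ 0) : s x = 0 := by
  obtain ⟨c, d, h, rfl⟩ := h
  have hc : inner A (c x) (c x) ≤ 0 := by
    rwa [← h.symm (c x) x]
  have hcx : c x = 0 := inner_self.1 (le_antisymm hc CStarModule.inner_self_nonneg)
  simp [hcx]

variable [StarOrderedRing A] [CompleteSpace E]

theorem isPositive_coe_iff {a : adjointable A E} : IsPositive A (a : E →L[ℂ] E) ↔ 0 ≤ a := by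
  rw [CStarAlgebra.nonneg_iff_eq_star_mul_self]
  constructor
  · rintro ⟨c, d, h, ha⟩
    refine ⟨⟨c, d, h⟩, Subtype.ext ?_⟩
    rw [star_eq_of_isAdjointPair (z := ⟨c, d, h⟩) (w := ⟨d, c, h.symm⟩) h]
    exact ha
  · rintro ⟨c, rfl⟩
    exact ⟨c, (star c : adjointable A E), isAdjointPair_star c, rfl⟩

theorem isPositive_of_inner_nonneg {r : E →L[ℂ] E} (hr : IsAdjointPair A r r)
    (h : ∀ x, 0 ≤ inner A (r x) x) : IsPositive A r := by
  let a : adjointable A E := ⟨r, r, hr⟩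
  have ha : IsSelfAdjoint a := star_eq_of_isAdjointPair hr
  let n : E →L[ℂ] E := (a⁻ : adjointable A E)
  have hn : IsPositive A n := isPositive_coe_iff.2 (CFC.negPart_nonneg a)
  have hrn (x : E) : r (n x) = -n (n x) := by
    have hmul : a * a⁻ = -(a⁻ * a⁻) := by
      nth_rewrite 1 [← CFC.posPart_sub_negPart a ha]
      rw [sub_mul, CFC.posPart_mul_negPart, zero_sub]
    exact congrArg (fun b : adjointable A E => b.1 x) hmul
  have hnn (x : E) : n (n x) = 0 := hn.apply_eq_zero_of_inner_nonpos <| by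
    have hx := h (n x)
    rwa [hrn, CStarModule.inner_neg_left, neg_nonneg] at hx
  have hn0 : a⁻ = 0 := Subtype.ext <| ContinuousLinearMap.ext fun x => by
    refine inner_self.1 (?_ : inner A (n x) (n x) = 0)
    rw [hn.isAdjointPair, hnn, CStarModule.inner_zero_right]
  exact isPositive_coe_iff.2 ((CFC.negPart_eq_zero_iff a ha).1 hn0)

theorem IsPositive.exists_comp_self_eq {r : E →L[ℂ] E} (hr : IsPositive A r) :
    ∃ s, IsPositive A s ∧ s ∘L s = r := by
  let a : adjointable A E := ⟨r, r, hr.isAdjointPair⟩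
  have ha : 0 ≤ a := isPositive_coe_iff.1 hr
  exact ⟨(CFC.sqrt a : adjointable A E), isPositive_coe_iff.2 (CFC.sqrt_nonneg a),
    congrArg Subtype.val (CFC.sqrt_mul_sqrt_self a ha)⟩

theorem IsPositive.eq_of_comp_self_eq {s t : E →L[ℂ] E} (hs : IsPositive A s)
    (ht : IsPositive A t) (h : s ∘L s = t ∘L t) : s = t := by
  let a : adjointable A E := ⟨s, s, hs.isAdjointPair⟩
  let b : adjointable A E := ⟨t, t, ht.isAdjointPair⟩
  have hab : a * a = b * b := Subtype.ext h
  have : a = b := by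
    rw [← CFC.sqrt_mul_self a (isPositive_coe_iff.1 hs), hab,
      CFC.sqrt_mul_self b (isPositive_coe_iff.1 ht)]
  exact congrArg Subtype.val this

namespace IsAdjointPair

variable {z : E →L[ℂ] F} {w : F →L[ℂ] E}

theorem isPositive_comp (h : IsAdjointPair A z w) : IsPositive A (w ∘L z) :=
  isPositive_of_inner_nonneg (h.symm.comp h) fun x => by
    rw [ContinuousLinearMap.comp_apply, h.symm]
    exact CStarModule.inner_self_nonneg

theorem exists_smul_add_eq (h : IsAdjointPair A z w) {c : ℝ} (hc : 0 < c) (y : E) :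
    ∃ x, c • x + w (z x) = y := by
  let a : adjointable A E := ⟨w ∘L z, _, h.symm.comp h⟩
  have ha : 0 ≤ a := isPositive_coe_iff.1 h.isPositive_comp
  have hunit : IsUnit (algebraMap ℝ (adjointable A E) c + a) :=
    ((isStrictlyPositive_algebraMap hc).add_nonneg ha).isUnit
  obtain ⟨b, hb⟩ := hunit.exists_right_inv
  refine ⟨b.1 y, ?_⟩
  have hby := congrArg (fun k : adjointable A E => k.1 y) hb
  simpa [Algebra.algebraMap_eq_smul_one] using! hby

theorem exists_norm_apply_sub_le (h : IsAdjointPair A z w) {d : ℝ} (hd : 0 < d) (v : F) :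
    ∃ x, ‖w v - w (z x)‖ ≤ d * ‖v‖ := by
  obtain ⟨x, hx⟩ := h.exists_smul_add_eq (pow_pos hd 2) (w v)
  have hinner : inner A (z x) v = inner A (d • x) (d • x) + inner A (z x) (z x) := by
    rw [h x v, ← hx, CStarModule.inner_add_right, h x]
    simp only [inner_smul_right_real, inner_smul_left_real, smul_smul, sq]
  have hzx : ‖z x‖ ≤ ‖v‖ := norm_le_of_inner_self_le_inner_left A <|
    hinner ▸ le_add_of_nonneg_left CStarModule.inner_self_nonneg
  have hdx : ‖d • x‖ ≤ ‖v‖ := norm_le_of_inner_self_le_inner A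
    (hinner ▸ le_add_of_nonneg_right CStarModule.inner_self_nonneg) hzx
  refine ⟨x, ?_⟩
  calc ‖w v - w (z x)‖ = ‖d • (d • x)‖ := by rw [← hx, add_sub_cancel_right, smul_smul, sq]
    _ = d * ‖d • x‖ := by rw [norm_smul, Real.norm_of_nonneg hd.le]
    _ ≤ d * ‖v‖ := by gcongr

theorem denseRange_comp_iff (h : IsAdjointPair A z w) : DenseRange (w ∘L z) ↔ DenseRange w := by
  refine ⟨fun hwz => hwz.mono (Set.range_comp_subset_range z w), fun hw => ?_⟩
  refine dense_closure.1 (hw.mono ?_)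
  rintro _ ⟨v, rfl⟩
  refine Metric.mem_closure_iff.2 fun ε hε => ?_
  obtain ⟨x, hx⟩ := h.exists_norm_apply_sub_le (div_pos hε (by positivity : 0 < ‖v‖ + 1)) v
  refine ⟨w (z x), ⟨x, rfl⟩, ?_⟩
  calc dist (w v) (w (z x)) ≤ ε / (‖v‖ + 1) * ‖v‖ := by rwa [dist_eq_norm]
    _ < ε / (‖v‖ + 1) * (‖v‖ + 1) := by gcongr; exact lt_add_one ‖v‖
    _ = ε := div_mul_cancel₀ ε (by positivity)

end IsAdjointPair

end Positive

variable {T : E →ₗ.[ℂ] F}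

section Adjoint

variable (A T) in
/-- The set of triples `(x, T x, T⋆ T x)` with `x` in the domain of `T⋆T`. Keeping the two values
next to `x` makes it a closed subspace. -/
def adjointMulGraph : Submodule ℂ (E × F × E) where
  carrier := {p | (p.1, p.2.1) ∈ T.graph ∧ p.2 ∈ (adjoint A T).graph}
  add_mem' hp hq := ⟨T.graph.add_mem hp.1 hq.1, (adjoint A T).graph.add_mem hp.2 hq.2⟩
  zero_mem' := ⟨T.graph.zero_mem, (adjoint A T).graph.zero_mem⟩
  smul_mem' c _ hp := ⟨T.graph.smul_mem c hp.1, (adjoint A T).graph.smul_mem c hp.2⟩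

variable (A T) in
/-- The operator `1 + T⋆T`. It is defined on the graph `adjointMulGraph A T` instead of the domain
of `T⋆T`, and is therefore bounded. -/
def oneAddAdjointMul : adjointMulGraph A T →L[ℂ] E :=
  (ContinuousLinearMap.fst ℂ E (F × E) +
    ContinuousLinearMap.snd ℂ F E ∘L ContinuousLinearMap.snd ℂ E (F × E)) ∘L
      (adjointMulGraph A T).subtypeL

theorem oneAddAdjointMul_apply (p : adjointMulGraph A T) :
    oneAddAdjointMul A T p = p.1.1 + p.1.2.2 := rfl

theorem range_oneAddAdjointMul :
    Set.range (oneAddAdjointMul A T) = rangeOneAddAdjointMul A T := by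
  ext y
  constructor
  · rintro ⟨⟨⟨x, u, w⟩, hx, hu⟩, rfl⟩
    obtain ⟨x, rfl, rfl⟩ := (LinearPMap.mem_graph_iff T).1 hx
    have hdom := LinearPMap.mem_domain_of_mem_graph hu
    exact ⟨x, hdom, congrArg (x.1 + ·)
      ((adjoint A T).mem_graph_snd_inj hu ((adjoint A T).mem_graph ⟨T x, hdom⟩) rfl)⟩
  · rintro ⟨x, h, rfl⟩
    exact ⟨⟨(x, T x, _), T.mem_graph x, (adjoint A T).mem_graph ⟨T x, h⟩⟩, rfl⟩

variable [StarOrderedRing A]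

theorem mem_graph_adjoint_iff (hT : Dense (T.domain : Set E)) {v : F} {w : E} :
    (v, w) ∈ (adjoint A T).graph ↔ ∀ x u, (x, u) ∈ T.graph → inner A u v = inner A x w := by
  rw [mem_graph_adjoint A hT]
  constructor
  · intro h x u hx
    obtain ⟨x, rfl, rfl⟩ := (LinearPMap.mem_graph_iff T).1 hx
    exact h x
  · exact fun h x => h _ _ (T.mem_graph x)

theorem inner_eq_of_mem_graph_adjoint (hT : Dense (T.domain : Set E)) {x w : E} {u v : F}
    (hx : (x, u) ∈ T.graph) (hv : (v, w) ∈ (adjoint A T).graph) : inner A w x = inner A v u :=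
  (inner_eq_inner_comm A).1 ((mem_graph_adjoint_iff hT).1 hv x u hx).symm

theorem isClosed_adjoint (hT : Dense (T.domain : Set E)) : (adjoint A T).IsClosed := by
  have hgraph : ((adjoint A T).graph : Set (F × E)) =
      ⋂ x : T.domain, {p | inner A (T x) p.1 = inner A (x : E) p.2} := by
    ext p
    rw [Set.mem_iInter]
    exact mem_graph_adjoint A hT p.1 p.2
  rw [LinearPMap.IsClosed, hgraph]
  exact isClosed_iInter fun x => isClosed_eq (by fun_prop) (by fun_prop)

theorem isModuleLinear_adjoint (hT : Dense (T.domain : Set E)) : IsModuleLinear A (adjoint A T) :=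
  isModuleLinear_iff.2 fun a v w h => (mem_graph_adjoint_iff hT).2 fun x u hx => by
    rw [inner_op_smul_right, inner_op_smul_right, (mem_graph_adjoint_iff hT).1 h x u hx]

theorem isClosed_adjointMulGraph (hT : Dense (T.domain : Set E)) (hTc : T.IsClosed) :
    IsClosed (adjointMulGraph A T : Set (E × F × E)) :=
  (hTc.preimage (by fun_prop : Continuous fun p : E × F × E => (p.1, p.2.1))).inter
    ((isClosed_adjoint hT).preimage continuous_snd)

theorem inner_fst_oneAddAdjointMul (hT : Dense (T.domain : Set E)) (p : adjointMulGraph A T) :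
    inner A p.1.1 (oneAddAdjointMul A T p) =
      inner A p.1.1 p.1.1 + inner A p.1.2.1 p.1.2.1 := by
  rw [oneAddAdjointMul_apply, CStarModule.inner_add_right,
    (mem_graph_adjoint_iff hT).1 p.2.2 _ _ p.2.1]

theorem norm_fst_le_norm_oneAddAdjointMul (hT : Dense (T.domain : Set E))
    (p : adjointMulGraph A T) : ‖p.1.1‖ ≤ ‖oneAddAdjointMul A T p‖ :=
  norm_le_of_inner_self_le_inner_left A <|
    inner_fst_oneAddAdjointMul hT p ▸ le_add_of_nonneg_right CStarModule.inner_self_nonneg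

theorem norm_snd_le_norm_oneAddAdjointMul (hT : Dense (T.domain : Set E))
    (p : adjointMulGraph A T) : ‖p.1.2.1‖ ≤ ‖oneAddAdjointMul A T p‖ :=
  norm_le_of_inner_self_le_inner A
    (inner_fst_oneAddAdjointMul hT p ▸ le_add_of_nonneg_left CStarModule.inner_self_nonneg)
    (norm_fst_le_norm_oneAddAdjointMul hT p)

theorem antilipschitzWith_oneAddAdjointMul (hT : Dense (T.domain : Set E)) :
    AntilipschitzWith 2 (oneAddAdjointMul A T) := by
  refine AddMonoidHomClass.antilipschitz_of_bound _ fun p => ?_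
  have hx := norm_fst_le_norm_oneAddAdjointMul hT p
  have hu := norm_snd_le_norm_oneAddAdjointMul hT p
  have hw : ‖p.1.2.2‖ ≤ ‖oneAddAdjointMul A T p‖ + ‖p.1.1‖ := by
    simpa only [oneAddAdjointMul_apply, add_sub_cancel_left] using
      norm_sub_le (oneAddAdjointMul A T p) p.1.1
  rw [← Submodule.norm_coe, Prod.norm_def, Prod.norm_def, NNReal.coe_ofNat]
  exact max_le (by linarith [norm_nonneg p.1.1])
    (max_le (by linarith [norm_nonneg p.1.2.1]) (by linarith))

theorem IsRegular.bijective_oneAddAdjointMul [CompleteSpace E] [CompleteSpace F]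
    (hT : IsRegular A T) : Function.Bijective (oneAddAdjointMul A T) := by
  have hanti : AntilipschitzWith 2 (oneAddAdjointMul A T) :=
    antilipschitzWith_oneAddAdjointMul hT.dense_domain
  refine ⟨hanti.injective, ?_⟩
  have : CompleteSpace (adjointMulGraph A T) :=
    (isClosed_adjointMulGraph hT.dense_domain hT.isClosed).completeSpace_coe
  have hclosed := hanti.isClosed_range (oneAddAdjointMul A T).uniformContinuous
  rw [← Set.range_eq_univ, ← hclosed.closure_eq, range_oneAddAdjointMul]
  exact hT.dense_range.closure_eq

end Adjoint

section Resolvent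

variable (A T) in
/-- `R = (1 + T⋆T)⁻¹` and `B = T R`, expressed by the fact that `T⋆ T R y = y - R y`. -/
def IsResolvent (R : E →L[ℂ] E) (B : E →L[ℂ] F) : Prop :=
  ∀ y, (R y, B y, y - R y) ∈ adjointMulGraph A T

variable [StarOrderedRing A]

theorem IsRegular.exists_isResolvent [CompleteSpace E] [CompleteSpace F] (hT : IsRegular A T) :
    ∃ R B, IsResolvent A T R B := by
  have : CompleteSpace (adjointMulGraph A T) :=
    (isClosed_adjointMulGraph hT.dense_domain hT.isClosed).completeSpace_coe
  let e := ContinuousLinearEquiv.ofBijective (oneAddAdjointMul A T)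
    (LinearMap.ker_eq_bot.2 hT.bijective_oneAddAdjointMul.1)
    (LinearMap.range_eq_top.2 hT.bijective_oneAddAdjointMul.2)
  let p : E →L[ℂ] E × F × E := (adjointMulGraph A T).subtypeL ∘L e.symm
  refine ⟨.fst ℂ E (F × E) ∘L p, .fst ℂ F E ∘L .snd ℂ E (F × E) ∘L p, fun y => ?_⟩
  have hy : (p y).1 + (p y).2.2 = y := e.apply_symm_apply y
  have hp : p y = ((p y).1, (p y).2.1, y - (p y).1) :=
    Prod.ext rfl (Prod.ext rfl (eq_sub_of_add_eq' hy))
  exact hp ▸ (e.symm y).2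

namespace IsResolvent

variable {R R' : E →L[ℂ] E} {B B' : E →L[ℂ] F} {C : F →L[ℂ] E}

theorem unique (hT : Dense (T.domain : Set E)) (h : IsResolvent A T R B)
    (h' : IsResolvent A T R' B') : R = R' := by
  ext y
  have heq : oneAddAdjointMul A T ⟨_, h y⟩ = oneAddAdjointMul A T ⟨_, h' y⟩ := by
    rw [oneAddAdjointMul_apply, oneAddAdjointMul_apply, add_sub_cancel, add_sub_cancel]
  exact congrArg (fun p => p.1.1) ((antilipschitzWith_oneAddAdjointMul hT).injective heq)

theorem inner_snd_apply (hT : Dense (T.domain : Set E)) (h : IsResolvent A T R B) {x : E} {u : F}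
    (hx : (x, u) ∈ T.graph) (y : E) : inner A u (B y) = inner A x (y - R y) :=
  (mem_graph_adjoint_iff hT).1 (h y).2 x u hx

theorem inner_eq (hT : Dense (T.domain : Set E)) (h : IsResolvent A T R B) (y y' : E) :
    inner A (R y) y' = inner A (B y) (B y') + inner A (R y) (R y') := by
  rw [h.inner_snd_apply hT (h y).1, CStarModule.inner_sub_right, sub_add_cancel]

theorem isAdjointPair (hT : Dense (T.domain : Set E)) (h : IsResolvent A T R B) :
    IsAdjointPair A R R := fun y y' => by
  rw [← star_inner (R y') y, h.inner_eq hT y, h.inner_eq hT y', star_add, star_inner, star_inner]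

theorem isPositive [CompleteSpace E] (hT : Dense (T.domain : Set E)) (h : IsResolvent A T R B) :
    IsPositive A R :=
  isPositive_of_inner_nonneg (h.isAdjointPair hT) fun y => by
    rw [h.inner_eq hT]
    exact add_nonneg CStarModule.inner_self_nonneg CStarModule.inner_self_nonneg

theorem inner_of_mem_graph_adjoint (hT : Dense (T.domain : Set E)) (h : IsResolvent A T R B)
    {v : F} {w : E} (hv : (v, w) ∈ (adjoint A T).graph) (y : E) :
    inner A (B y) v = inner A y (R w) := by
  rw [(mem_graph_adjoint_iff hT).1 hv _ _ (h y).1, h.isAdjointPair hT]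

theorem exists_isAdjointPair [CompleteSpace E] (hT : Dense (T.domain : Set E))
    (hT' : Dense ((adjoint A T).domain : Set F)) (h : IsResolvent A T R B) :
    ∃ C, IsAdjointPair A B C :=
  exists_isAdjointPair_of_dense B hT' fun v hv =>
    ⟨_, h.inner_of_mem_graph_adjoint hT ((adjoint A T).mem_graph ⟨v, hv⟩)⟩

theorem add_apply_eq (hT : Dense (T.domain : Set E)) (h : IsResolvent A T R B)
    (hC : IsAdjointPair A B C) {x : E} {u : F}
    (hx : ∀ v w, (v, w) ∈ (adjoint A T).graph → inner A w x = inner A v u) :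
    R x + C u = x :=
  ext_inner_left A fun y => by
    rw [CStarModule.inner_add_right, ← hC, ← h.isAdjointPair hT, ← hx _ _ (h y).2,
      ← CStarModule.inner_add_left, add_sub_cancel]

theorem apply_eq_of_mem_graph_adjoint (hT : Dense (T.domain : Set E)) (h : IsResolvent A T R B)
    (hC : IsAdjointPair A B C) {v : F} {w : E} (hv : (v, w) ∈ (adjoint A T).graph) : C v = R w :=
  ext_inner_left A fun y => by rw [← hC, h.inner_of_mem_graph_adjoint hT hv]

-- `x = R x + B⋆ T x` on the dense domain of `T`, and `B⋆ = R T⋆` on the dense domain of `T⋆`.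
theorem denseRange [CompleteSpace E] (hT : Dense (T.domain : Set E))
    (hT' : Dense ((adjoint A T).domain : Set F)) (h : IsResolvent A T R B) : DenseRange R := by
  obtain ⟨C, hC⟩ := h.exists_isAdjointPair hT hT'
  let K : Submodule ℂ E := R.range.topologicalClosure
  have hRK (y : E) : R y ∈ K := R.range.le_topologicalClosure ⟨y, rfl⟩
  have hCK (u : F) : C u ∈ K := by
    refine (R.range.isClosed_topologicalClosure.preimage C.continuous).closure_subset_iff.2
      (fun v hv => ?_) (hT' u)
    rw [Set.mem_preimage, h.apply_eq_of_mem_graph_adjoint hT hC ((adjoint A T).mem_graph ⟨v, hv⟩)]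
    exact hRK _
  refine dense_closure.1 (hT.mono fun x hx => ?_)
  have hRC : R x + C (T ⟨x, hx⟩) = x := h.add_apply_eq hT hC fun v w hv =>
    inner_eq_of_mem_graph_adjoint hT (T.mem_graph ⟨x, hx⟩) hv
  exact hRC ▸ K.add_mem (hRK x) (hCK _)

end IsResolvent

end Resolvent

section ZTransform

variable {z : E →L[ℂ] F} {w : F →L[ℂ] E} {s R : E →L[ℂ] E} {B : E →L[ℂ] F}

variable (A T) in
/-- `z` satisfies the conditions on a `z`-transform of `T` other than `‖z‖ ≤ 1`, where `w = z⋆` and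
`s = (1 - z⋆z)^(1/2)`. The two conditions on `T` say that its graph is `{(s v, z v) | v ∈ E}`. -/
structure IsZTransformWith (z : E →L[ℂ] F) (w : F →L[ℂ] E) (s : E →L[ℂ] E) : Prop where
  isPositive : IsPositive A s
  isAdjointPair : IsAdjointPair A z w
  sqrt_sqrt_apply : ∀ v, s (s v) = v - w (z v)
  mem_graph : ∀ v, (s v, z v) ∈ T.graph
  exists_of_mem_graph : ∀ x u, (x, u) ∈ T.graph → ∃ v, s v = x ∧ z v = u

theorem isZTransform_iff :
    IsZTransform A T z ↔ ‖z‖ ≤ 1 ∧ ∃ w s, IsZTransformWith A T z w s := by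
  refine and_congr_right fun _ => ⟨?_, ?_⟩
  · rintro ⟨s, ⟨hs, w, hw, hss⟩, hdom, hTs⟩
    have hmem (v : E) : s v ∈ T.domain := by
      rw [← SetLike.mem_coe, hdom]
      exact ⟨v, rfl⟩
    refine ⟨w, s, hs, hw, fun v => congrArg (fun k => k v) hss,
      fun v => hTs v (hmem v) ▸ T.mem_graph ⟨s v, hmem v⟩, fun x u hx => ?_⟩
    have hxs : x ∈ (T.domain : Set E) := LinearPMap.mem_domain_of_mem_graph hx
    rw [hdom] at hxs
    obtain ⟨v, rfl⟩ := hxs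
    exact ⟨v, rfl, hTs v (hmem v) ▸ T.mem_graph_snd_inj (T.mem_graph ⟨s v, hmem v⟩) hx rfl⟩
  · rintro ⟨w, s, h⟩
    refine ⟨s, ⟨h.isPositive, w, h.isAdjointPair, ContinuousLinearMap.ext h.sqrt_sqrt_apply⟩,
      Set.Subset.antisymm (fun x hx => ?_) ?_,
      fun v hv => T.mem_graph_snd_inj (T.mem_graph ⟨s v, hv⟩) (h.mem_graph v) rfl⟩
    · obtain ⟨v, hv, -⟩ := h.exists_of_mem_graph x _ (T.mem_graph ⟨x, hx⟩)
      exact ⟨v, hv⟩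
    · rintro _ ⟨v, rfl⟩
      exact LinearPMap.mem_domain_of_mem_graph (h.mem_graph v)

theorem IsZTransformWith.denseRange_iff (h : IsZTransformWith A T z w s) :
    DenseRange T ↔ DenseRange z := by
  have hrange : Set.range T = Set.range z := by
    ext u
    rw [LinearPMap.mem_range_iff]
    constructor
    · rintro ⟨x, hx⟩
      obtain ⟨v, -, rfl⟩ := h.exists_of_mem_graph x u hx
      exact ⟨v, rfl⟩
    · rintro ⟨v, rfl⟩
      exact ⟨s v, h.mem_graph v⟩
  rw [DenseRange, DenseRange, hrange]

theorem IsZTransformWith.denseRange_sqrt (hT : Dense (T.domain : Set E))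
    (h : IsZTransformWith A T z w s) : DenseRange s :=
  hT.mono fun x hx => by
    obtain ⟨v, hv, -⟩ := h.exists_of_mem_graph x _ (T.mem_graph ⟨x, hx⟩)
    exact ⟨v, hv⟩

variable [StarOrderedRing A]

-- `z` extends `T R s⁻¹`, which is contractive because `⟨B y, B y⟩ ≤ ⟨R y, y⟩ = ⟨s y, s y⟩`.
theorem IsResolvent.exists_extension [CompleteSpace F] (hT : Dense (T.domain : Set E))
    (hTc : T.IsClosed) (h : IsResolvent A T R B) (hs : IsAdjointPair A s s)
    (hsR : ∀ y, s (s y) = R y) (hds : DenseRange s) :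
    ∃ z : E →L[ℂ] F, ‖z‖ ≤ 1 ∧ (∀ y, z (s y) = B y) ∧ ∀ v, (s v, z v) ∈ T.graph := by
  have hbound (y : E) : ‖B.toLinearMap y‖ ≤ 1 * ‖s.toLinearMap y‖ := by
    rw [one_mul]
    refine norm_le_of_inner_self_le_inner A
      (?_ : inner A (B y) (B y) ≤ inner A (s y) (s y)) le_rfl
    rw [← hs.symm, hsR, h.inner_eq hT]
    exact le_add_of_nonneg_right CStarModule.inner_self_nonneg
  let z : E →L[ℂ] F := B.toLinearMap.extendOfNorm s.toLinearMap
  have hzs (y : E) : z (s y) = B y :=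
    LinearMap.extendOfNorm_eq (e := s.toLinearMap) hds ⟨1, hbound⟩ y
  refine ⟨z, LinearMap.opNorm_extendOfNorm_le (e := s.toLinearMap) hds zero_le_one hbound, hzs,
    fun v => hds.induction (P := fun v => (s v, z v) ∈ T.graph) ?_
      (hTc.preimage (s.continuous.prodMk z.continuous)) v⟩
  rintro _ ⟨y, rfl⟩
  rw [hsR, hzs]
  exact (h y).1

theorem exists_isAdjointPair_of_mem_graph [CompleteSpace E] (hT : Dense (T.domain : Set E))
    (hT' : Dense ((adjoint A T).domain : Set F)) (hs : IsAdjointPair A s s)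
    (hg : ∀ v, (s v, z v) ∈ T.graph) : ∃ w, IsAdjointPair A z w :=
  exists_isAdjointPair_of_dense z hT' fun v hv => ⟨s (adjoint A T ⟨v, hv⟩), fun x => by
    rw [(mem_graph_adjoint_iff hT).1 ((adjoint A T).mem_graph ⟨v, hv⟩) _ _ (hg x), hs]⟩

theorem IsResolvent.isZTransformWith (hT : Dense (T.domain : Set E)) (h : IsResolvent A T R B)
    (hs : IsPositive A s) (hsR : ∀ y, s (s y) = R y) (hds : DenseRange s)
    (hzw : IsAdjointPair A z w) (hzs : ∀ y, z (s y) = B y) (hg : ∀ v, (s v, z v) ∈ T.graph) :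
    IsZTransformWith A T z w s where
  isPositive := hs
  isAdjointPair := hzw
  sqrt_sqrt_apply := by
    have hwB (y : E) : w (B y) = s (y - R y) := ext_inner_left A fun v => by
      rw [← hzw, h.inner_snd_apply hT (hg v), hs.isAdjointPair]
    refine congrFun (hds.equalizer (by fun_prop) (by fun_prop) (funext fun y => ?_))
    rw [Function.comp_apply, Function.comp_apply, hzs, hwB, map_sub, sub_sub_cancel, ← hsR]
  mem_graph := hg
  exists_of_mem_graph x u hx := by
    have hB : IsAdjointPair A B (s ∘L w) := fun y v => by
      rw [← hzs, hzw, hs.isAdjointPair, ContinuousLinearMap.comp_apply]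
    have hsx : s (s x + w u) = x := by
      rw [map_add, hsR]
      exact h.add_apply_eq hT hB fun _ _ hv => inner_eq_of_mem_graph_adjoint hT hx hv
    exact ⟨s x + w u, hsx, T.mem_graph_snd_inj (hg _) hx hsx⟩

theorem IsRegular.exists_isZTransform [CompleteSpace E] [CompleteSpace F] (hT : IsRegular A T) :
    ∃ z : E →L[ℂ] F, IsZTransform A T z := by
  have hd := hT.dense_domain
  obtain ⟨R, B, h⟩ := hT.exists_isResolvent
  obtain ⟨s, hs, rfl⟩ := (h.isPositive hd).exists_comp_self_eq
  have hds : DenseRange s := (h.denseRange hd hT.dense_adjoint_domain).mono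
    (Set.range_comp_subset_range s s)
  obtain ⟨z, hz, hzs, hg⟩ :=
    h.exists_extension hd hT.isClosed hs.isAdjointPair (fun _ => rfl) hds
  obtain ⟨w, hzw⟩ :=
    exists_isAdjointPair_of_mem_graph hd hT.dense_adjoint_domain hs.isAdjointPair hg
  exact ⟨z, isZTransform_iff.2
    ⟨hz, w, s, h.isZTransformWith hd hs (fun _ => rfl) hds hzw hzs hg⟩⟩

namespace IsZTransformWith

theorem mem_adjointMulGraph (hT : Dense (T.domain : Set E)) (h : IsZTransformWith A T z w s)
    (y : E) : (s (s y), z (s y), w (z y)) ∈ adjointMulGraph A T := by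
  refine ⟨h.mem_graph (s y), (mem_graph_adjoint_iff hT).2 fun x u hx => ?_⟩
  obtain ⟨v, rfl, rfl⟩ := h.exists_of_mem_graph x u hx
  have hcomm : w (z (s y)) = s (w (z y)) := by
    rw [← sub_sub_cancel (s y) (w (z (s y))), ← h.sqrt_sqrt_apply, h.sqrt_sqrt_apply y, map_sub,
      sub_sub_cancel]
  rw [h.isAdjointPair, hcomm, h.isPositive.isAdjointPair v]

theorem isResolvent (hT : Dense (T.domain : Set E)) (h : IsZTransformWith A T z w s) :
    IsResolvent A T (s ∘L s) (z ∘L s) := fun y => by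
  have hy := h.mem_adjointMulGraph hT y
  rwa [← sub_sub_cancel y (w (z y)), ← h.sqrt_sqrt_apply] at hy

end IsZTransformWith

theorem IsZTransform.unique [CompleteSpace E] (hT : Dense (T.domain : Set E)) {z' : E →L[ℂ] F}
    (h : IsZTransform A T z) (h' : IsZTransform A T z') : z = z' := by
  obtain ⟨-, w, s, h⟩ := isZTransform_iff.1 h
  obtain ⟨-, w', s', h'⟩ := isZTransform_iff.1 h'
  obtain rfl : s = s' := h.isPositive.eq_of_comp_self_eq h'.isPositive
    ((h.isResolvent hT).unique hT (h'.isResolvent hT))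
  ext v
  exact T.mem_graph_snd_inj (h.mem_graph v) (h'.mem_graph v) rfl

end ZTransform

section Biadjoint

variable [StarOrderedRing A] [CompleteSpace E] [CompleteSpace F]

theorem IsRegular.adjoint_adjoint (hT : IsRegular A T) : adjoint A (adjoint A T) = T := by
  have hle {x : E} {u : F} (hx : (x, u) ∈ T.graph) : (x, u) ∈ (adjoint A (adjoint A T)).graph :=
    (mem_graph_adjoint_iff hT.dense_adjoint_domain).2 fun v w hv =>
      inner_eq_of_mem_graph_adjoint hT.dense_domain hx hv
  refine LinearPMap.eq_of_eq_graph (Submodule.ext fun ⟨x, u⟩ => ⟨fun hx => ?_, hle⟩)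
  obtain ⟨z, hz⟩ := hT.exists_isZTransform
  obtain ⟨-, w, s, hz⟩ := isZTransform_iff.1 hz
  have hsx : s (s x) + s (w u) = x := (hz.isResolvent hT.dense_domain).add_apply_eq hT.dense_domain
    (hz.isAdjointPair.comp hz.isPositive.isAdjointPair)
    ((mem_graph_adjoint_iff hT.dense_adjoint_domain).1 hx)
  have hg := hz.mem_graph (s x + w u)
  rw [map_add, hsx] at hg
  exact (adjoint A (adjoint A T)).mem_graph_snd_inj (hle hg) hx rfl ▸ hg

-- `v = (v - T R T⋆ v) + T R T⋆ v`, and `T⋆ (v - T R T⋆ v) = R T⋆ v`.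
theorem IsRegular.exists_add_eq (hT : IsRegular A T) {v : F} (hv : v ∈ (adjoint A T).domain) :
    ∃ v' x u, (v', x) ∈ (adjoint A T).graph ∧ (x, u) ∈ T.graph ∧ v' + u = v := by
  obtain ⟨R, B, h⟩ := hT.exists_isResolvent
  let y := adjoint A T ⟨v, hv⟩
  have hBy := (adjoint A T).graph.sub_mem ((adjoint A T).mem_graph ⟨v, hv⟩) (h y).2
  rw [Prod.mk_sub_mk, sub_sub_cancel] at hBy
  exact ⟨v - B y, R y, B y, hBy, (h y).1, sub_add_cancel _ _⟩

theorem IsRegular.isRegular_adjoint (hT : IsRegular A T) : IsRegular A (adjoint A T) where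
  isModuleLinear := isModuleLinear_adjoint hT.dense_domain
  dense_domain := hT.dense_adjoint_domain
  isClosed := isClosed_adjoint hT.dense_domain
  dense_adjoint_domain := hT.adjoint_adjoint.symm ▸ hT.dense_domain
  dense_range := hT.dense_adjoint_domain.mono fun v hv => by
    obtain ⟨v', x, u, hv', hx, rfl⟩ := hT.exists_add_eq hv
    rw [← range_oneAddAdjointMul]
    exact ⟨⟨(v', x, u), hv', hT.adjoint_adjoint.symm ▸ hx⟩, rfl⟩

end Biadjoint

section Inverse

variable [StarOrderedRing A]

theorem mem_graph_adjoint_inverse (hT : Dense (T.domain : Set E)) (hi : Function.Injective T)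
    (hd : DenseRange T) {v : F} {w : E} :
    (w, v) ∈ (adjoint A T.inverse).graph ↔ (v, w) ∈ (adjoint A T).graph := by
  rw [mem_graph_adjoint_iff hT, mem_graph_adjoint_iff (by rwa [coe_domain_inverse])]
  simp only [mem_graph_inverse hi]
  exact ⟨fun h x u hx => (h u x hx).symm, fun h u x hx => (h x u hx).symm⟩

theorem coe_domain_adjoint_inverse (hT : Dense (T.domain : Set E)) (hi : Function.Injective T)
    (hd : DenseRange T) : ((adjoint A T.inverse).domain : Set E) = Set.range (adjoint A T) := by
  ext w
  rw [SetLike.mem_coe, LinearPMap.mem_domain_iff, LinearPMap.mem_range_iff]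
  simp only [mem_graph_adjoint_inverse hT hi hd]

theorem injective_of_denseRange_adjoint (hT : Dense (T.domain : Set E))
    (hd : DenseRange (adjoint A T)) : Function.Injective T := by
  refine (injective_iff_map_eq_zero T.toFun).2 fun x (hx : T x = 0) => Subtype.ext ?_
  refine ext_inner_left_of_dense A hd ?_
  rintro _ ⟨v, rfl⟩
  rw [inner_eq_of_mem_graph_adjoint hT (T.mem_graph x) ((adjoint A T).mem_graph v), hx,
    CStarModule.inner_zero_right, ZeroMemClass.coe_zero, CStarModule.inner_zero_right]

variable [CompleteSpace E] [CompleteSpace F]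

theorem IsRegular.isRegular_inverse (hT : IsRegular A T) (hi : Function.Injective T)
    (hd : DenseRange T) (hd' : DenseRange (adjoint A T)) : IsRegular A T.inverse where
  isModuleLinear := isModuleLinear_iff.2 fun a u x h => by
    rw [mem_graph_inverse hi] at h ⊢
    exact isModuleLinear_iff.1 hT.isModuleLinear a x u h
  dense_domain := by rwa [coe_domain_inverse]
  isClosed := (LinearPMap.inverse_closed_iff (LinearMap.ker_eq_bot.2 hi)).2 hT.isClosed
  dense_adjoint_domain := by rwa [coe_domain_adjoint_inverse hT.dense_domain hi hd]
  dense_range := hT.dense_adjoint_domain.mono fun v hv => by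
    obtain ⟨v', x, u, hv', hx, rfl⟩ := hT.exists_add_eq hv
    rw [← range_oneAddAdjointMul]
    exact ⟨⟨(u, x, v'), (mem_graph_inverse hi).2 hx,
      (mem_graph_adjoint_inverse hT.dense_domain hi hd).2 hv'⟩, add_comm u v'⟩

theorem IsRegular.isInvertible_iff (hT : IsRegular A T) :
    IsInvertible A T ↔ DenseRange T ∧ DenseRange (adjoint A T) := by
  constructor
  · rintro ⟨hi, hinv⟩
    have hd := hinv.dense_domain
    rw [coe_domain_inverse] at hd
    have hd' := hinv.dense_adjoint_domain
    rw [coe_domain_adjoint_inverse hT.dense_domain hi hd] at hd'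
    exact ⟨hd, hd'⟩
  · rintro ⟨hd, hd'⟩
    have hi := injective_of_denseRange_adjoint hT.dense_domain hd'
    exact ⟨hi, hT.isRegular_inverse hi hd hd'⟩

end Inverse

section Bounded

variable [StarOrderedRing A] {z : E →L[ℂ] F} {w : F →L[ℂ] E} {s : E →L[ℂ] E}

namespace IsAdjointPair

theorem adjoint_ofCLM (h : IsAdjointPair A z w) : adjoint A (ofCLM z) = ofCLM w := by
  refine LinearPMap.eq_of_eq_graph (Submodule.ext fun ⟨v, y⟩ => ?_)
  rw [mem_graph_adjoint_iff (dense_domain_ofCLM z), mem_graph_ofCLM]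
  constructor
  · intro hv
    exact ext_inner_left A fun x => by rw [← h, hv x _ (mem_graph_ofCLM.2 rfl)]
  · rintro rfl x u hx
    rw [← mem_graph_ofCLM.1 hx, h]

theorem isRegular_ofCLM [CompleteSpace E] (h : IsAdjointPair A z w) : IsRegular A (ofCLM z) where
  isModuleLinear := isModuleLinear_iff.2 fun a x u hx => by
    rw [mem_graph_ofCLM] at hx ⊢
    rw [h.map_smul, hx]
  dense_domain := dense_domain_ofCLM z
  isClosed := isClosed_ofCLM z
  dense_adjoint_domain := h.adjoint_ofCLM ▸ dense_domain_ofCLM w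
  dense_range := dense_univ.mono fun y _ => by
    obtain ⟨x, hx⟩ := h.exists_smul_add_eq one_pos y
    rw [one_smul] at hx
    rw [← range_oneAddAdjointMul]
    exact ⟨⟨(x, z x, w (z x)), mem_graph_ofCLM.2 rfl, h.adjoint_ofCLM ▸ mem_graph_ofCLM.2 rfl⟩, hx⟩

theorem isInvertible_ofCLM_iff [CompleteSpace E] [CompleteSpace F] (h : IsAdjointPair A z w) :
    IsInvertible A (ofCLM z) ↔ DenseRange z ∧ DenseRange w := by
  rw [h.isRegular_ofCLM.isInvertible_iff, h.adjoint_ofCLM]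
  simp only [DenseRange, range_ofCLM]

end IsAdjointPair

theorem IsZTransformWith.denseRange_adjoint_iff [CompleteSpace E]
    (hT : Dense (T.domain : Set E)) (h : IsZTransformWith A T z w s) :
    DenseRange (adjoint A T) ↔ DenseRange w := by
  constructor
  · intro hd
    refine ((h.denseRange_sqrt hT).comp hd s.continuous).mono ?_
    rintro _ ⟨v, rfl⟩
    refine ⟨v, ext_inner_left A fun x => ?_⟩
    rw [← h.isAdjointPair, Function.comp_apply, ← h.isPositive.isAdjointPair]
    exact (mem_graph_adjoint_iff hT).1 ((adjoint A T).mem_graph v) _ _ (h.mem_graph x)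
  · intro hw
    refine (h.isAdjointPair.denseRange_comp_iff.2 hw).mono ?_
    rintro _ ⟨y, rfl⟩
    exact LinearPMap.mem_range_iff.2 ⟨_, (h.mem_adjointMulGraph hT y).2⟩

theorem IsZTransform.isInvertible_iff [CompleteSpace E] [CompleteSpace F] (hT : IsRegular A T)
    (hz : IsZTransform A T z) : IsInvertible A T ↔ IsInvertible A (ofCLM z) := by
  obtain ⟨-, w, s, hz⟩ := isZTransform_iff.1 hz
  rw [hT.isInvertible_iff, hz.isAdjointPair.isInvertible_ofCLM_iff, hz.denseRange_iff,
    hz.denseRange_adjoint_iff hT.dense_domain]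

theorem IsRegular.dense_range_adjointMulGraph [CompleteSpace E] [CompleteSpace F]
    (hT : IsRegular A T) (hd : DenseRange (adjoint A T)) :
    Dense {y | ∃ x u, (x, u, y) ∈ adjointMulGraph A T} := by
  obtain ⟨z, hz⟩ := hT.exists_isZTransform
  obtain ⟨-, w, s, hz⟩ := isZTransform_iff.1 hz
  have hw : DenseRange w := (hz.denseRange_adjoint_iff hT.dense_domain).1 hd
  refine (hz.isAdjointPair.denseRange_comp_iff.2 hw).mono ?_
  rintro _ ⟨y, rfl⟩
  exact ⟨_, _, hz.mem_adjointMulGraph hT.dense_domain y⟩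

end Bounded

section Normal

namespace IsNormal

variable {T : E →ₗ.[ℂ] E}

theorem inner_self_eq (hn : IsNormal A T) {x a b : E} (ha : (x, a) ∈ T.graph)
    (hb : (x, b) ∈ (adjoint A T).graph) : inner A a a = inner A b b := by
  have hx := LinearPMap.mem_domain_of_mem_graph ha
  have hx' := LinearPMap.mem_domain_of_mem_graph hb
  rw [T.mem_graph_snd_inj ha (T.mem_graph ⟨x, hx⟩) rfl,
    (adjoint A T).mem_graph_snd_inj hb ((adjoint A T).mem_graph ⟨x, hx'⟩) rfl]
  exact hn.2 x hx hx'

theorem inner_eq (hn : IsNormal A T) {x x' a a' b b' : E}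
    (ha : (x, a) ∈ T.graph) (ha' : (x', a') ∈ T.graph)
    (hb : (x, b) ∈ (adjoint A T).graph) (hb' : (x', b') ∈ (adjoint A T).graph) :
    inner A a a' = inner A b b' := by
  have key (c : ℂ) : inner A (a + c • a') (a + c • a') = inner A (b + c • b') (b + c • b') :=
    hn.inner_self_eq (T.graph.add_mem ha (T.graph.smul_mem c ha'))
      ((adjoint A T).graph.add_mem hb ((adjoint A T).graph.smul_mem c hb'))
  refine smul_right_injective A (by norm_num : (4 : ℂ) ≠ 0) ?_
  simp only [four_smul_inner_eq_sum, key]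

variable [StarOrderedRing A]

-- This is the inclusion of `T T⋆` in `T⋆ T`.
theorem exists_mem_adjointMulGraph (hT : Dense (T.domain : Set E)) (hn : IsNormal A T)
    {v x y : E} (hv : (v, x) ∈ (adjoint A T).graph) (hx : (x, y) ∈ T.graph) :
    ∃ u, (v, u, y) ∈ adjointMulGraph A T := by
  have hvT : v ∈ T.domain := hn.1 ▸ LinearPMap.mem_domain_of_mem_graph hv
  have hu := T.mem_graph ⟨v, hvT⟩
  refine ⟨T ⟨v, hvT⟩, hu, (mem_graph_adjoint_iff hT).2 fun p q hpq => ?_⟩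
  have hp : p ∈ (adjoint A T).domain := hn.1 ▸ LinearPMap.mem_domain_of_mem_graph hpq
  have hp' := (adjoint A T).mem_graph ⟨p, hp⟩
  rw [hn.inner_eq hpq hu hp' hv]
  exact inner_eq_of_mem_graph_adjoint hT hx hp'

theorem isInvertible_iff [CompleteSpace E] (hT : IsRegular A T) (hn : IsNormal A T) :
    IsInvertible A T ↔ DenseRange T := by
  rw [hT.isInvertible_iff]
  refine ⟨And.left, fun hd => ⟨hd, ?_⟩⟩
  have hdense := hT.isRegular_adjoint.dense_range_adjointMulGraph
    (hT.adjoint_adjoint.symm ▸ hd)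
  refine hdense.mono fun y hy => ?_
  obtain ⟨v, x, hv, hx⟩ := hy
  rw [hT.adjoint_adjoint] at hx
  obtain ⟨u, -, hu⟩ := hn.exists_mem_adjointMulGraph hT.dense_domain hv hx
  exact LinearPMap.mem_range_iff.2 ⟨u, hu⟩

end IsNormal

end Normal

end HilbertModule

theorem mainTheorem3 {A E F : Type*}
    [NonUnitalCStarAlgebra A] [PartialOrder A] [StarOrderedRing A]
    [NormedAddCommGroup E] [NormedSpace ℂ E] [SMul A E] [CStarModule A E] [CompleteSpace E]
    [NormedAddCommGroup F] [NormedSpace ℂ F] [SMul A F] [CStarModule A F] [CompleteSpace F] :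
    -- `T` is invertible iff `T` and its adjoint have dense range
    (∀ T : E →ₗ.[ℂ] F, HilbertModule.IsRegular A T →
      (HilbertModule.IsInvertible A T ↔
        DenseRange T ∧ DenseRange (HilbertModule.adjoint A T))) ∧
    -- `T` has a unique `z`-transform, and `T` is invertible iff its `z`-transform is
    (∀ T : E →ₗ.[ℂ] F, HilbertModule.IsRegular A T →
      (∃! z : E →L[ℂ] F, HilbertModule.IsZTransform A T z) ∧
      ∀ z : E →L[ℂ] F, HilbertModule.IsZTransform A T z →
        (HilbertModule.IsInvertible A T ↔
          HilbertModule.IsInvertible A (HilbertModule.ofCLM z))) ∧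
    -- a normal `T` is invertible iff it has dense range
    (∀ T : E →ₗ.[ℂ] E, HilbertModule.IsRegular A T → HilbertModule.IsNormal A T →
      (HilbertModule.IsInvertible A T ↔ DenseRange T)) := by
  refine ⟨fun T hT => hT.isInvertible_iff, fun T hT => ⟨?_, fun z hz => hz.isInvertible_iff hT⟩,
    fun T hT hn => hn.isInvertible_iff hT⟩
  obtain ⟨z, hz⟩ := hT.exists_isZTransform
  exact ⟨z, hz, fun z' hz' => hz'.unique hT.dense_domain hz⟩
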